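/- Let $\alpha<0$, $\tilde\alpha>0$, $\beta>0$ and $\gamma\neq 0$ be real numbers, and let $f\colon\mathbb{R}^4\to\mathbb{R}^4$ be the map $$f(x,y,z,\omega)=\bigl(y,\ \alpha x+\beta z+\gamma\sin x,\ \omega,\ \tilde\alpha x-\beta z-\gamma\sin x\bigr).$$ Then the set of periodic points of $f$, that is, of all $p\in\mathbb{R}^4$ with $f^n(p)=p$ for some integer $n\ge 1$, is not dense in $\mathbb{R}^4$. Consequently $f$ is not chaotic on $\mathbb{R}^4$ in the sense of Devaney; that is, it is not true that $f$ simultaneously has sensitive dependence on initial conditions, is topologically transitive, and has a dense set of periodic points. -/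

import Mathlib

noncomputable section

/-- The discrete map `(x, y, z, ω) ↦ (y, α x + β z + γ sin x, ω, α' x - β z - γ sin x)` of `ℝ⁴`,
where `α'` stands for `α̃` and the coordinates `x, y, z, ω` are `p 0, p 1, p 2, p 3`. -/
def zieglerMap (α α' β γ : ℝ) (p : EuclideanSpace ℝ (Fin 4)) : EuclideanSpace ℝ (Fin 4) :=
  !₂[p 1,
    α * p 0 + β * p 2 + γ * Real.sin (p 0),
    p 3,
    α' * p 0 - β * p 2 - γ * Real.sin (p 0)]

/-- Topological transitivity of a self-map: for any two nonempty open sets `U`, `V`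
some forward iterate `f^k(U)`, `k > 0`, meets `V`. -/
def IsTopTransitive {X : Type*} [TopologicalSpace X] (f : X → X) : Prop :=
  ∀ U V : Set X, IsOpen U → U.Nonempty → IsOpen V → V.Nonempty →
    ∃ k : ℕ, 0 < k ∧ ((f^[k] '' U) ∩ V).Nonempty

/-- Sensitive dependence on initial conditions: there is `δ > 0` such that every neighbourhood of
every point `x` contains a `y` with `dist (f^n x) (f^n y) > δ` for some `n`. -/
def HasSensitiveDependence {X : Type*} [MetricSpace X] (f : X → X) : Prop :=
  ∃ δ : ℝ, 0 < δ ∧ ∀ x : X, ∀ N ∈ nhds x, ∃ y ∈ N, ∃ n : ℕ, δ < dist (f^[n] x) (f^[n] y)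

/-- Devaney's definition of a chaotic self-map of a metric space. -/
structure IsDevaneyChaotic {X : Type*} [MetricSpace X] (f : X → X) : Prop where
  sensitive : HasSensitiveDependence f
  transitive : IsTopTransitive f
  dense_periodic : Dense (Function.periodicPts f)

end

/-! The second iterate acts on `(x, z)` alone, as a linear map plus a bounded sine term. Pairing
with a left eigenvector whose eigenvalue has modulus other than 1 gives an almost geometric
sequence, which can return only from a bounded start. So periodic points lie in a strip. -/

/-- The linear part of the second iterate of `zieglerMap` has a real eigenvalue off the
unit circle. -/
theorem exists_eigenvalue_abs_ne_one {α α' β : ℝ} (hα : α < 0) (hα' : 0 < α') (hβ : 0 < β) :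
    ∃ l : ℝ, l ^ 2 = (α - β) * l + β * (α + α') ∧ |l| ≠ 1 := by
  have hD : 0 < (α - β) ^ 2 + 4 * (β * (α + α')) := by
    -- The discriminant equals `(α + β) ^ 2 + 4 * β * α'`.
    nlinarith [sq_nonneg (α + β), mul_pos hβ hα']
  set s := Real.sqrt ((α - β) ^ 2 + 4 * (β * (α + α'))) with hs
  have hs0 : 0 < s := Real.sqrt_pos.2 hD
  have hsq : s ^ 2 = (α - β) ^ 2 + 4 * (β * (α + α')) := Real.sq_sqrt hD.le
  by_cases h : |(α - β - s) / 2| = 1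
  · refine ⟨(α - β + s) / 2, by linear_combination hsq / 4, fun h' => ?_⟩
    -- Equal roots contradict `0 < s`; opposite roots contradict trace `α - β < 0`.
    rcases abs_eq_abs.1 (h.trans h'.symm) with h | h <;> linarith
  · exact ⟨(α - β - s) / 2, by linear_combination hsq / 4, h⟩

/-- A real sequence that returns to its initial value and is, up to an error `C`, geometric with
ratio `l`, `|l| ≠ 1`, starts at distance at most `C / |1 - (|l|)|` from the origin. -/
theorem abs_mul_abs_le_of_return {u : ℕ → ℝ} {l C : ℝ} (hl : |l| ≠ 1)
    (hu : ∀ k, |u (k + 1) - l * u k| ≤ C) {n : ℕ} (hn : 0 < n) (hret : u n = u 0) :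
    |1 - (|l|)| * |u 0| ≤ C := by
  -- Otherwise every later `|u k|` stays strictly on one side of `|u 0|`.
  by_contra! hC
  rcases lt_or_gt_of_ne hl with h | h
  · rw [abs_of_pos (sub_pos.2 h)] at hC
    have key : ∀ k, |u k| ≤ |u 0| → |u (k + 1)| < |u 0| := fun k hk => by
      have h1 := abs_sub_abs_le_abs_sub (u (k + 1)) (l * u k)
      rw [abs_mul] at h1
      linarith [hu k, mul_le_mul_of_nonneg_left hk (abs_nonneg l)]
    have all : ∀ k, |u (k + 1)| < |u 0| := fun k => by
      induction k with
      | zero => exact key 0 le_rfl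
      | succ k ih => exact key _ ih.le
    have := all (n - 1)
    rw [Nat.sub_add_cancel hn, hret] at this
    exact lt_irrefl _ this
  · rw [abs_of_neg (sub_neg.2 h)] at hC
    have key : ∀ k, |u 0| ≤ |u k| → |u 0| < |u (k + 1)| := fun k hk => by
      have h1 := abs_sub_abs_le_abs_sub (l * u k) (u (k + 1))
      rw [abs_mul, abs_sub_comm] at h1
      linarith [hu k, mul_le_mul_of_nonneg_left hk (sub_pos.2 h).le]
    have all : ∀ k, |u 0| < |u (k + 1)| := fun k => by
      induction k with
      | zero => exact key 0 le_rfl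
      | succ k ih => exact key _ ih.le
    have := all (n - 1)
    rw [Nat.sub_add_cancel hn, hret] at this
    exact lt_irrefl _ this

/-- A left eigenvector of the linear part of the second iterate of `zieglerMap` is semiconjugated
to multiplication by the eigenvalue, up to a bounded term. -/
theorem eigenfunctional_zieglerMap_zieglerMap {α α' β : ℝ} (γ : ℝ) {l : ℝ}
    (hl : l ^ 2 = (α - β) * l + β * (α + α')) (p : EuclideanSpace ℝ (Fin 4)) :
    (l + β) * zieglerMap α α' β γ (zieglerMap α α' β γ p) 0
        + β * zieglerMap α α' β γ (zieglerMap α α' β γ p) 2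
      = l * ((l + β) * p 0 + β * p 2) + l * γ * Real.sin (p 0) := by
  simp [zieglerMap]
  linear_combination -(p 0) * hl

theorem abs_eigenfunctional_le_of_mem_periodicPts {α α' β γ l : ℝ}
    (hl : l ^ 2 = (α - β) * l + β * (α + α')) (hl1 : |l| ≠ 1) {p : EuclideanSpace ℝ (Fin 4)}
    (hp : p ∈ Function.periodicPts (zieglerMap α α' β γ)) :
    |1 - (|l|)| * |(l + β) * p 0 + β * p 2| ≤ |l * γ| := by
  obtain ⟨n, hn, hper⟩ := hp
  refine abs_mul_abs_le_of_return
    (u := fun k => (l + β) * (zieglerMap α α' β γ)^[2 * k] p 0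
      + β * (zieglerMap α α' β γ)^[2 * k] p 2) hl1 (fun k => ?_) hn ?_
  · simp only [mul_add_one, Function.iterate_succ_apply']
    rw [eigenfunctional_zieglerMap_zieglerMap γ hl, add_sub_cancel_left, abs_mul]
    exact mul_le_of_le_one_right (abs_nonneg _) (Real.abs_sin_le_one _)
  · have h : (zieglerMap α α' β γ)^[2 * n] p = p := hper.const_mul 2
    simp only [h, mul_zero, Function.iterate_zero, id]

theorem not_dense_periodicPts_zieglerMap {α α' β : ℝ} (γ : ℝ) (hα : α < 0) (hα' : 0 < α')
    (hβ : 0 < β) : ¬ Dense (Function.periodicPts (zieglerMap α α' β γ)) := by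
  intro hd
  obtain ⟨l, hl, hl1⟩ := exists_eigenvalue_abs_ne_one hα hα' hβ
  have hpos : 0 < |1 - (|l|)| := abs_pos.2 (sub_ne_zero.2 hl1.symm)
  obtain ⟨p, hp, hper⟩ := hd.inter_open_nonempty
    {p : EuclideanSpace ℝ (Fin 4) | |l * γ| < |1 - (|l|)| * |(l + β) * p 0 + β * p 2|}
    (isOpen_lt (by fun_prop) (by fun_prop))
    -- Chosen so that the right-hand side is exactly `|l * γ| + 1`.
    ⟨!₂[0, 0, (|l * γ| + 1) / |1 - (|l|)| / β, 0], by
      have h : 0 ≤ (|l * γ| + 1) / |1 - (|l|)| := by positivity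
      change |l * γ| < |1 - (|l|)| * |(l + β) * 0 + β * ((|l * γ| + 1) / |1 - (|l|)| / β)|
      rw [mul_zero, zero_add, mul_div_cancel₀ _ hβ.ne', abs_of_nonneg h, mul_div_cancel₀ _ hpos.ne']
      exact lt_add_one _⟩
  exact absurd (abs_eigenfunctional_le_of_mem_periodicPts hl hl1 hper) (not_le.2 hp)

theorem propositionA1 (α α' β γ : ℝ) (hα : α < 0) (hα' : 0 < α') (hβ : 0 < β) (hγ : γ ≠ 0) :
    ¬ Dense (Function.periodicPts (zieglerMap α α' β γ)) ∧
      ¬ IsDevaneyChaotic (zieglerMap α α' β γ) :=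
  have h := not_dense_periodicPts_zieglerMap γ hα hα' hβ
  ⟨h, fun hc => h hc.dense_periodic⟩
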